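/- **Theorem 3.2.** Let $n\ge k\ge 1$ be integers and $[n]=\{1,\dots,n\}$. Let $\mathcal{OP}_n^k$ be the set of ordered partitions $\pi=B_1/B_2/\cdots/B_k$ of $[n]$ into $k$ blocks, i.e. sequences of $k$ pairwise disjoint nonempty sets with union $[n]$. The opener (closer) of a block is its least (greatest) element; $\mathrm{open}(\pi)$ and $\mathrm{clos}(\pi)$ are the sets of openers and of closers of the blocks of $\pi$, and $w_i$ is the index $j$ with $i\in B_j$. Put $$\mathrm{ros}\,\pi=\sum_{i=1}^n\#\{j\in\mathrm{open}(\pi): j<i,\ w_j>w_i\},\qquad \mathrm{lob}\,\pi=\sum_{i=1}^n\#\{j\in\mathrm{open}(\pi): j>i,\ w_j<w_i\},$$ $$\mathrm{lcs}\,\pi=\sum_{i=1}^n\#\{j\in\mathrm{clos}(\pi): j<i,\ w_j<w_i\},\qquad \mathrm{rcb}\,\pi=\sum_{i=1}^n\#\{j\in\mathrm{clos}(\pi): j>i,\ w_j>w_i\},$$ $$\mathrm{lsb}\,\pi=\sum_{i=1}^n\#\{b: b<w_i,\ \min B_b<i<\max B_b\},\qquad \mathrm{bInv}\,\pi=\#\{(a,b):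 a<b,\ \min B_a>\max B_b\},$$ and $$\mathrm{MAK}=\mathrm{ros}+\mathrm{lcs},\qquad \mathrm{MAK}'=\mathrm{lob}+\mathrm{rcb},\qquad \mathrm{cinvLSB}=\mathrm{lsb}+\Bigl(\tbinom k2-\mathrm{bInv}\Bigr)+\tbinom k2 .$$ Let $[m]_{p,q}=\sum_{i=0}^{m-1}p^{m-1-i}q^i$ and $[k]_{p,q}!=\prod_{j=1}^k[j]_{p,q}$. Let the $p,q$-Stirling numbers of the second kind be defined, for integers $N,m\ge 0$, by $S_{p,q}(0,0)=1$, by $S_{p,q}(N,m)=p^{m-1}S_{p,q}(N-1,m-1)+[m]_{p,q}S_{p,q}(N-1,m)$ if $0<m\le N$, and by $S_{p,q}(N,m)=0$ in all other cases. Then, for each $\mathrm{maf}\in\{\mathrm{MAK},\mathrm{MAK}'\}$, $$\sum_{\pi\in\mathcal{OP}_n^k}p^{(\mathrm{maf}+\mathrm{bInv})\,\pi}\,q^{\mathrm{cinvLSB}\,\pi}=q^{\binom k2}\,[k]_{p,q}!\,S_{p,q}(n,k)$$ for all elements $p,q$ of any commutative semiring (in particular, for indeterminates $p,q$). Moreover,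 the three statistics $\mathrm{MAK}+\mathrm{bInv}$, $\mathrm{MAK}'+\mathrm{bInv}$ and $\mathrm{cinvLSB}$ are Euler-Mahonian on $\mathcal{OP}_n^k$: each of them, as $\mathrm{stat}$, satisfies the polynomial identity $$\sum_{\pi\in\mathcal{OP}_n^k}q^{\mathrm{stat}\,\pi}=[k]_q!\,S_q(n,k),$$ where $[m]_q=1+q+\cdots+q^{m-1}$, $[k]_q!=\prod_{j=1}^k[j]_q$ and $S_q(n,k)=S_{q,1}(n,k)$ (that is, $S_{p,q}(n,k)$ with $p$ replaced by $q$ and $q$ replaced by $1$). -/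

import Mathlib

/-- Ordered partitions of an `n`-element chain into `k` blocks: sequences `B₁/B₂/⋯/Bₖ` of pairwise
disjoint nonempty subsets whose union is everything. The set `[n] = {1, …, n}` is represented by
`Fin n` (only the order of the letters matters), and positions of blocks by `Fin k`. -/
abbrev OrderedSetPartition (n k : ℕ) : Type :=
  {B : Fin k → Finset (Fin n) //
    (∀ b, (B b).Nonempty) ∧ (∀ b c, b ≠ c → Disjoint (B b) (B c)) ∧ ∀ i, ∃ b, i ∈ B b}

namespace OrderedSetPartition

variable {n k : ℕ}

/-- The `b`-th block, counting from left to right. -/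
def block (π : OrderedSetPartition n k) (b : Fin k) : Finset (Fin n) := π.1 b

/-- The opener (least element) of the `b`-th block. -/
def opener (π : OrderedSetPartition n k) (b : Fin k) : Fin n := (π.block b).min' (π.2.1 b)

/-- The closer (greatest element) of the `b`-th block. -/
def closer (π : OrderedSetPartition n k) (b : Fin k) : Fin n := (π.block b).max' (π.2.1 b)

/-- The set of openers of the blocks. -/
def openers (π : OrderedSetPartition n k) : Finset (Fin n) := Finset.univ.image π.opener

/-- The set of closers of the blocks. -/
def closers (π : OrderedSetPartition n k) : Finset (Fin n) := Finset.univ.image π.closer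

theorem existsUnique_mem_block (π : OrderedSetPartition n k) (i : Fin n) :
    ∃! b, b ∈ (Finset.univ : Finset (Fin k)) ∧ i ∈ π.block b := by
  obtain ⟨b, hb⟩ := π.2.2.2 i
  refine ⟨b, ⟨Finset.mem_univ b, hb⟩, ?_⟩
  rintro c ⟨-, hc⟩
  by_contra hne
  exact Finset.disjoint_left.mp (π.2.2.1 c b hne) hc hb

/-- `w_i`: the index of the block containing `i`. -/
def idx (π : OrderedSetPartition n k) (i : Fin n) : Fin k :=
  Finset.choose (fun b => i ∈ π.block b) Finset.univ (π.existsUnique_mem_block i)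

theorem mem_block_idx (π : OrderedSetPartition n k) (i : Fin n) : i ∈ π.block (π.idx i) :=
  Finset.choose_property (fun b => i ∈ π.block b) Finset.univ (π.existsUnique_mem_block i)

/-- `ros_i` (right, opener, smaller). -/
def rosAt (π : OrderedSetPartition n k) (i : Fin n) : ℕ :=
  (π.openers.filter fun j => j < i ∧ π.idx i < π.idx j).card

/-- `lob_i` (left, opener, bigger). -/
def lobAt (π : OrderedSetPartition n k) (i : Fin n) : ℕ :=
  (π.openers.filter fun j => i < j ∧ π.idx j < π.idx i).card

/-- `lcs_i` (left, closer, smaller). -/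
def lcsAt (π : OrderedSetPartition n k) (i : Fin n) : ℕ :=
  (π.closers.filter fun j => j < i ∧ π.idx j < π.idx i).card

/-- `rcb_i` (right, closer, bigger). -/
def rcbAt (π : OrderedSetPartition n k) (i : Fin n) : ℕ :=
  (π.closers.filter fun j => i < j ∧ π.idx i < π.idx j).card

/-- `lsb_i`: the number of blocks to the left of the block containing `i` whose opener is smaller
than `i` and whose closer is greater than `i`. -/
def lsbAt (π : OrderedSetPartition n k) (i : Fin n) : ℕ :=
  (Finset.univ.filter fun b : Fin k => b < π.idx i ∧ π.opener b < i ∧ i < π.closer b).card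

def ros (π : OrderedSetPartition n k) : ℕ := ∑ i, π.rosAt i

def lob (π : OrderedSetPartition n k) : ℕ := ∑ i, π.lobAt i

def lcs (π : OrderedSetPartition n k) : ℕ := ∑ i, π.lcsAt i

def rcb (π : OrderedSetPartition n k) : ℕ := ∑ i, π.rcbAt i

def lsb (π : OrderedSetPartition n k) : ℕ := ∑ i, π.lsbAt i

/-- `MAK = ros + lcs`. -/
def mak (π : OrderedSetPartition n k) : ℕ := π.ros + π.lcs

/-- `MAK' = lob + rcb`. -/
def mak' (π : OrderedSetPartition n k) : ℕ := π.lob + π.rcb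

/-- The number of block inversions: pairs of positions `b < c` such that every letter of the
block at `b` is greater than every letter of the block at `c`. -/
def bInv (π : OrderedSetPartition n k) : ℕ :=
  (Finset.univ.filter fun x : Fin k × Fin k => x.1 < x.2 ∧ π.closer x.2 < π.opener x.1).card

/-- A block inversion is in particular a pair of positions, so that the subtraction in `cbInv`
is a genuine one. -/
theorem bInv_le_choose (π : OrderedSetPartition n k) : π.bInv ≤ k.choose 2 := by
  have h : k.choose 2 = ((Finset.univ : Finset (Fin k)).powersetCard 2).card := by simp
  rw [h]
  unfold bInv
  refine Finset.card_le_card_of_injOn (fun x => {x.1, x.2}) ?_ ?_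
  · intro x hx
    have hx' := (Finset.mem_filter.mp hx).2.1
    simp [Finset.mem_powersetCard, Finset.card_pair hx'.ne]
  · rintro ⟨a, b⟩ hx ⟨c, d⟩ hy hxy
    have h1 : a < b := (Finset.mem_filter.mp hx).2.1
    have h2 : c < d := (Finset.mem_filter.mp hy).2.1
    have hs : ({a, b} : Finset (Fin k)) = {c, d} := hxy
    have ha : a ∈ ({c, d} : Finset (Fin k)) := hs ▸ (by simp)
    have hb : b ∈ ({c, d} : Finset (Fin k)) := hs ▸ (by simp)
    have hc : c ∈ ({a, b} : Finset (Fin k)) := hs ▸ (by simp)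
    simp only [Finset.mem_insert, Finset.mem_singleton] at ha hb hc
    ext <;> grind

/-- The complementary statistic `cbInv = C(k,2) - bInv`. -/
def cbInv (π : OrderedSetPartition n k) : ℕ := k.choose 2 - π.bInv

/-- `cinvLSB = lsb + cbInv + C(k,2)`. -/
def cinvLSB (π : OrderedSetPartition n k) : ℕ := π.lsb + π.cbInv + k.choose 2

end OrderedSetPartition

/-- `[k]_{p,q} = p^(k-1) + p^(k-2) q + ⋯ + q^(k-1)`, with `[0]_{p,q} = 0`. -/
def pqNumber {R : Type*} [CommSemiring R] (p q : R) (k : ℕ) : R :=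
  ∑ i ∈ Finset.range k, p ^ (k - 1 - i) * q ^ i

/-- `[k]_{p,q}! = [1]_{p,q} [2]_{p,q} ⋯ [k]_{p,q}`. -/
def pqFactorial {R : Type*} [CommSemiring R] (p q : R) (k : ℕ) : R :=
  ∏ j ∈ Finset.range k, pqNumber p q (j + 1)

/-- The `p,q`-Stirling numbers of the second kind `S_{p,q}(n,k)`. -/
def pqStirling {R : Type*} [CommSemiring R] (p q : R) : ℕ → ℕ → R
  | 0, 0 => 1
  | 0, _ + 1 => 0
  | _ + 1, 0 => 0
  | n + 1, k + 1 =>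
    if k + 1 ≤ n + 1 then
      p ^ k * pqStirling p q n k + pqNumber p q (k + 1) * pqStirling p q n (k + 1)
    else 0

/-- `[k]_q = 1 + q + ⋯ + q^(k-1)`. -/
def qNumber {R : Type*} [CommSemiring R] (q : R) (k : ℕ) : R := ∑ i ∈ Finset.range k, q ^ i

/-- `[k]_q! = [1]_q [2]_q ⋯ [k]_q`. -/
def qFactorial {R : Type*} [CommSemiring R] (q : R) (k : ℕ) : R :=
  ∏ j ∈ Finset.range k, qNumber q (j + 1)

/-- The `q`-Stirling numbers of the second kind `S_q(n,k) = S_{q,1}(n,k)`. -/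
def qStirling {R : Type*} [CommSemiring R] (q : R) (n k : ℕ) : R := pqStirling q 1 n k

/-- A statistic on the ordered partitions of `[n]` into `k` blocks is Euler-Mahonian if its
generating polynomial in the indeterminate `q` is `[k]_q! S_q(n,k)`. -/
def IsEulerMahonian {n k : ℕ} (stat : OrderedSetPartition n k → ℕ) : Prop :=
  ∑ π : OrderedSetPartition n k, (Polynomial.X : Polynomial ℕ) ^ stat π =
    qFactorial (Polynomial.X : Polynomial ℕ) k * qStirling (Polynomial.X : Polynomial ℕ) n k

/-! ### Identities for p,q-numbers and p,q-Stirling numbers. -/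

section Algebra

variable {R : Type*} [CommSemiring R] (p q : R)

/-! Encode an ordered partition by its surjective word `idx` and read it letter by letter. Before a
letter, let O be the set of opened blocks, A ⊆ O the active ones, c = |O \ A| and a = |A|. All
statistics become sums of local terms. A closed block is counted by MAK exactly once at each letter,
and an unopened block other than the letter's own by MAK'. What remains depends on (c, a) and on the
rank of the letter's block: in A if it joins a block, in O if it opens one. Hence the weight of a
partition is a `wordWeight`, and `α`, `β` alone distinguish MAK from MAK'.

Now sum over words, fixing only the size of A. The ranks of a joined block sum to [a]. The ranks of
the m-th block opened, among the m labels then in use, sum to [m], with a further factor q^(m-1).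
Thus [k]! q^C(k,2) splits off (`sum_stateSum`), leaving weighted lattice paths in (c, a) from (0,0)
to (k,0).

These sum to S_{p,q}(n,k) for both weights (`pathSum_mak`, `pathSum_mak'`). The proofs are
inductions on closed forms, over the end state for MAK and over the start state for MAK', resting on
[x+y] = p^x [y] + q^y [x] (`pqNumber_add`). Setting q = 1 or p = 1 gives the Euler-Mahonian claims.
-/

theorem pqNumber_zero : pqNumber p q 0 = 0 := by simp [pqNumber]

theorem pqNumber_one : pqNumber p q 1 = 1 := by simp [pqNumber]

/-- The two parts of `[c + a]_{p,q}`. -/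
theorem pqNumber_add (c a : ℕ) :
    pqNumber p q (c + a) = p ^ c * pqNumber p q a + q ^ a * pqNumber p q c := by
  unfold pqNumber
  rw [add_comm c a, Finset.sum_range_add, Finset.mul_sum, Finset.mul_sum]
  congr 1
  · refine Finset.sum_congr rfl fun i hi => ?_
    have hi := Finset.mem_range.mp hi
    rw [← mul_assoc, ← pow_add]
    congr 2
    omega
  · refine Finset.sum_congr rfl fun i hi => ?_
    have hi := Finset.mem_range.mp hi
    rw [mul_left_comm, ← pow_add]
    congr 2
    omega

theorem pqFactorial_succ (k : ℕ) :
    pqFactorial p q (k + 1) = pqFactorial p q k * pqNumber p q (k + 1) :=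
  Finset.prod_range_succ _ _

/-- The Stirling numbers `p ^ (-C(m,2)) S_{p,q}(n,m)`. -/
def reducedStirling : ℕ → ℕ → R
  | 0, 0 => 1
  | 0, _ + 1 => 0
  | _ + 1, 0 => 0
  | n + 1, m + 1 => reducedStirling n m + pqNumber p q (m + 1) * reducedStirling n (m + 1)

theorem reducedStirling_eq_zero_of_lt {n m : ℕ} (h : n < m) : reducedStirling p q n m = 0 := by
  induction n generalizing m with
  | zero => obtain _ | m := m <;> simp_all [reducedStirling]
  | succ n ih =>
    obtain _ | m := m
    · omega
    · rw [reducedStirling, ih (by omega), ih (by omega)]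
      simp

theorem pqStirling_eq (n m : ℕ) :
    pqStirling p q n m = p ^ m.choose 2 * reducedStirling p q n m := by
  induction n generalizing m with
  | zero => obtain _ | m := m <;> simp [reducedStirling, pqStirling]
  | succ n ih =>
    obtain _ | m := m
    · simp [reducedStirling, pqStirling]
    · rw [pqStirling]
      split_ifs with h
      · rw [reducedStirling, ih, ih, Nat.choose_succ_succ' m 1, Nat.choose_one_right, pow_add]
        ring
      · rw [reducedStirling_eq_zero_of_lt p q (by omega), mul_zero]

/-- `[u + 1]_{p,q} [u + 2]_{p,q} ⋯ [u + a]_{p,q}`. -/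
def pqAscFactorial (u a : ℕ) : R := ∏ i ∈ Finset.range a, pqNumber p q (u + i + 1)

theorem pqAscFactorial_zero (u : ℕ) : pqAscFactorial p q u 0 = 1 := by simp [pqAscFactorial]

theorem pqAscFactorial_succ (u a : ℕ) :
    pqAscFactorial p q u (a + 1) = pqAscFactorial p q u a * pqNumber p q (u + a + 1) :=
  Finset.prod_range_succ _ _

theorem pqAscFactorial_succ' (u a : ℕ) :
    pqAscFactorial p q u (a + 1) = pqNumber p q (u + 1) * pqAscFactorial p q (u + 1) a := by
  unfold pqAscFactorial
  rw [Finset.prod_range_succ', mul_comm]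
  congr 1
  refine Finset.prod_congr rfl fun i _ => ?_
  congr 1
  omega

/-! ### Weighted lattice paths on the states (c, a). -/

/-- The transfer operator on functions of a state `(c, a)`, with `c` closed and `a` active blocks:
a letter either joins an active block or opens a block, and in both cases the block is then either
kept active or closed. -/
def transfer (α β : ℕ → ℕ → R) (h : ℕ → ℕ → R) (c a : ℕ) : R :=
  β c a * pqNumber p q a * (h c a + h (c + 1) (a - 1)) + α c a * (h c (a + 1) + h (c + 1) a)

theorem transfer_add (α β h h' : ℕ → ℕ → R) :
    transfer p q α β (h + h') = transfer p q α β h + transfer p q α β h' := by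
  funext c a
  simp only [transfer, Pi.add_apply]
  ring

theorem transfer_smul (α β h : ℕ → ℕ → R) (r : R) :
    transfer p q α β (r • h) = r • transfer p q α β h := by
  funext c a
  simp only [transfer, Pi.smul_apply, smul_eq_mul]
  ring

theorem transfer_iterate_add (α β h h' : ℕ → ℕ → R) (n : ℕ) :
    (transfer p q α β)^[n] (h + h') =
      (transfer p q α β)^[n] h + (transfer p q α β)^[n] h' := by
  induction n generalizing h h' with
  | zero => rfl
  | succ n ih => simp only [Function.iterate_succ_apply, transfer_add, ih]

theorem transfer_iterate_smul (α β h : ℕ → ℕ → R) (r : R) (n : ℕ) :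
    (transfer p q α β)^[n] (r • h) = r • (transfer p q α β)^[n] h := by
  induction n generalizing h with
  | zero => rfl
  | succ n ih => simp only [Function.iterate_succ_apply, transfer_smul, ih]

/-- The indicator function of the state `(c, a)`. -/
def stateIndicator (R : Type*) [CommSemiring R] (c a : ℕ) : ℕ → ℕ → R :=
  fun c' a' => if c' = c ∧ a' = a then 1 else 0

/-- The total weight of the paths of length `n` from `(0, 0)` to `(c, a)`. -/
def pathSum (α β : ℕ → ℕ → R) (n c a : ℕ) : R :=
  (transfer p q α β)^[n] (stateIndicator R c a) 0 0

/-- The part of `pathSum` due to paths whose last step increases the number of blocks. -/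
def pathSumOpen (α β : ℕ → ℕ → R) (n : ℕ) : ℕ → ℕ → R
  | 0, 0 => 0
  | c + 1, 0 => α c 0 * pathSum p q α β n c 0
  | 0, a + 1 => α 0 a * pathSum p q α β n 0 a
  | c + 1, a + 1 =>
    α (c + 1) a * pathSum p q α β n (c + 1) a + α c (a + 1) * pathSum p q α β n c (a + 1)

/-- The part of `pathSum` due to paths whose last step closes an active block. -/
def pathSumClose (α β : ℕ → ℕ → R) (n : ℕ) : ℕ → ℕ → R
  | 0, _ => 0
  | c + 1, a => β c (a + 1) * pqNumber p q (a + 1) * pathSum p q α β n c (a + 1)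

theorem pathSum_zero (α β : ℕ → ℕ → R) (c a : ℕ) :
    pathSum p q α β 0 c a = if c = 0 ∧ a = 0 then 1 else 0 := by
  simp [pathSum, stateIndicator, eq_comm]

/-- The innermost application of `transfer` is the last step of the path: it turns the indicator of
a state into a combination of indicators of its at most four predecessors, and the remaining iterate
is linear. -/
theorem pathSum_succ (α β : ℕ → ℕ → R) (n c a : ℕ) :
    pathSum p q α β (n + 1) c a =
      β c a * pqNumber p q a * pathSum p q α β n c a + pathSumClose p q α β n c a +
        pathSumOpen p q α β n c a := by
  have key : ∀ (h₁ h₂ h₃ h₄ : ℕ → ℕ → R) (r₁ r₂ r₃ r₄ : R),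
      transfer p q α β (stateIndicator R c a) = r₁ • h₁ + r₂ • h₂ + (r₃ • h₃ + r₄ • h₄) →
      pathSum p q α β (n + 1) c a =
        r₁ * (transfer p q α β)^[n] h₁ 0 0 + r₂ * (transfer p q α β)^[n] h₂ 0 0 +
        (r₃ * (transfer p q α β)^[n] h₃ 0 0 + r₄ * (transfer p q α β)^[n] h₄ 0 0) := by
    intro h₁ h₂ h₃ h₄ r₁ r₂ r₃ r₄ h
    rw [pathSum, Function.iterate_succ_apply, h]
    simp only [transfer_iterate_add, transfer_iterate_smul, Pi.add_apply, Pi.smul_apply,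
      smul_eq_mul]
  obtain _ | c := c <;> obtain _ | a := a
  · rw [key (stateIndicator R 0 0) 0 0 0 (β 0 0 * pqNumber p q 0) 0 0 0]
    · simp [pathSumOpen, pathSumClose, pathSum]
    · funext c' a'
      obtain _ | a' := a' <;> simp [transfer, stateIndicator, pqNumber_zero]
  · rw [key (stateIndicator R 0 (a + 1)) 0 (stateIndicator R 0 a) 0
      (β 0 (a + 1) * pqNumber p q (a + 1)) 0 (α 0 a) 0]
    · simp [pathSumOpen, pathSumClose, pathSum]
    · funext c' a'
      simp only [transfer, stateIndicator, Pi.add_apply, Pi.smul_apply, smul_eq_mul]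
      split_ifs <;> first | omega | simp_all
  · rw [key (stateIndicator R (c + 1) 0) (stateIndicator R c 1) (stateIndicator R c 0) 0
      (β (c + 1) 0 * pqNumber p q 0) (β c 1 * pqNumber p q 1) (α c 0) 0]
    · simp [pathSumOpen, pathSumClose, pathSum]
    · funext c' a'
      obtain _ | a' := a'
      · simp only [transfer, stateIndicator, Pi.add_apply, Pi.smul_apply, smul_eq_mul]
        split_ifs <;> first | omega | simp_all [pqNumber_zero]
      · simp only [transfer, stateIndicator, Pi.add_apply, Pi.smul_apply, smul_eq_mul]
        split_ifs <;> first | omega | simp_all [pqNumber_zero]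
  · rw [key (stateIndicator R (c + 1) (a + 1)) (stateIndicator R c (a + 2))
      (stateIndicator R (c + 1) a) (stateIndicator R c (a + 1))
      (β (c + 1) (a + 1) * pqNumber p q (a + 1)) (β c (a + 2) * pqNumber p q (a + 2))
      (α (c + 1) a) (α c (a + 1))]
    · simp [pathSumOpen, pathSumClose, pathSum]
    · funext c' a'
      simp only [transfer, stateIndicator, Pi.add_apply, Pi.smul_apply, smul_eq_mul]
      split_ifs <;> first | omega | simp_all

theorem choose_two_succ (m : ℕ) : (m + 1).choose 2 = m + m.choose 2 := by
  rw [Nat.choose_succ_succ' m 1, Nat.choose_one_right]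

/-- The path sums with weights `p ^ c q ^ a` for opening a block and `p ^ c [a]_{p,q}` for
joining one. -/
theorem pqFactorial_mul_pathSum (n c a : ℕ) :
    pqFactorial p q a * pathSum p q (fun c a => p ^ c * q ^ a) (fun c _ => p ^ c) n c a =
      reducedStirling p q n (c + a) * pqAscFactorial p q c a *
        (p ^ c.choose 2 * q ^ a.choose 2) := by
  -- The factor [a]! on the left replaces a division: the path sum itself carries the p,q-binomial
  -- coefficient of c + a over a.
  induction n generalizing c a with
  | zero =>
    rw [pathSum_zero]
    obtain _ | c := c <;> obtain _ | a := a
    · simp [pqFactorial, reducedStirling, pqAscFactorial]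
    all_goals simp [reducedStirling]
  | succ n ih =>
    rw [pathSum_succ]
    obtain _ | c := c <;> obtain _ | a := a
    · simp [pathSumOpen, pathSumClose, pqNumber_zero, reducedStirling]
    · rw [zero_add (a + 1)]
      have h1 := ih 0 (a + 1)
      have h2 := ih 0 a
      simp only [pathSumOpen, pathSumClose, zero_add, reducedStirling, pow_zero, one_mul,
        add_zero, mul_add, Nat.choose_zero_succ] at h1 h2 ⊢
      rw [mul_left_comm, h1, pqFactorial_succ]
      rw [show pqFactorial p q a * pqNumber p q (a + 1) *
        (q ^ a * pathSum p q (fun c a => p ^ c * q ^ a) (fun c _ => p ^ c) n 0 a) =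
        q ^ a * pqNumber p q (a + 1) * (pqFactorial p q a *
          pathSum p q (fun c a => p ^ c * q ^ a) (fun c _ => p ^ c) n 0 a) by ring, h2,
        choose_two_succ, pow_add, pqAscFactorial_succ, zero_add]
      ring
    · have h1 := ih (c + 1) 0
      have h2 := ih c 0
      have h3 := ih c 1
      simp only [pathSumOpen, pathSumClose, zero_add, reducedStirling, pow_zero, one_mul,
        add_zero, mul_add, pqNumber_zero, mul_zero, zero_mul, pqNumber_one, pqFactorial_succ,
        pqAscFactorial_succ, pqAscFactorial_zero, mul_one] at h1 h2 h3 ⊢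
      rw [mul_left_comm, h3, mul_left_comm (pqFactorial p q 0), h2, choose_two_succ c, pow_add]
      simp
      ring
    · have h1 := ih (c + 1) (a + 1)
      have h2 := ih c (a + 2)
      have h3 := ih (c + 1) a
      have h4 := ih c (a + 1)
      -- Used twice, with m = c + a + 2: it merges `h1`, `h2` into the term [m] of the Stirling
      -- recursion, and `h3`, `h4` into the last factor [m] of the ascending factorial.
      have e1 := pqNumber_add p q (c + 1) (a + 1)
      simp only [pathSumOpen, pathSumClose]
      set f := pathSum p q (fun c a => p ^ c * q ^ a) (fun c _ => p ^ c) n with hf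
      rw [show c + 1 + (a + 1) = c + a + 1 + 1 by omega] at h1 e1 ⊢
      rw [show c + (a + 2) = c + a + 1 + 1 by omega] at h2
      rw [show c + 1 + a = c + a + 1 by omega] at h3
      rw [show c + (a + 1) = c + a + 1 by omega] at h4
      calc _ = p ^ (c + 1) * pqNumber p q (a + 1) * (pqFactorial p q (a + 1) * f (c + 1) (a + 1))
            + p ^ c * (pqFactorial p q (a + 2) * f c (a + 2))
            + (p ^ (c + 1) * q ^ a * pqNumber p q (a + 1) * (pqFactorial p q a * f (c + 1) a)
            + p ^ c * q ^ (a + 1) * (pqFactorial p q (a + 1) * f c (a + 1))) := by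
            rw [pqFactorial_succ p q (a + 1), pqFactorial_succ p q a]; ring
        _ = _ := by
            rw [h1, h2, h3, h4, reducedStirling, pqAscFactorial_succ' p q c (a + 1),
              pqAscFactorial_succ' p q c a, pqAscFactorial_succ p q (c + 1) a,
              show c + 1 + a + 1 = c + a + 1 + 1 by omega, e1, choose_two_succ c,
              choose_two_succ (a + 1), choose_two_succ a]
            ring

theorem pathSum_mak (n k : ℕ) :
    pathSum p q (fun c a => p ^ c * q ^ a) (fun c _ => p ^ c) n k 0 = pqStirling p q n k := by
  have h := pqFactorial_mul_pathSum p q n k 0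
  rw [pqStirling_eq]
  simpa [pqFactorial, pqAscFactorial, mul_comm] using h

/-- The iterates of the transfer operator with weights `p ^ (u - 1) q ^ a` for opening a block and
`p ^ u [a]_{p,q}` for joining one, where `u` is the number of blocks still to be opened. -/
theorem transfer_iterate_stateIndicator (n k c a : ℕ) :
    (transfer p q (fun c a => p ^ (k - (c + a + 1)) * q ^ a) (fun c a => p ^ (k - (c + a))))^[n]
      (stateIndicator R k 0) c a =
      if c + a ≤ k then
        p ^ (k - (c + a)).choose 2 * reducedStirling p q n (k - c) *
          pqAscFactorial p q (k - (c + a)) a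
      else 0 := by
  induction n generalizing c a with
  | zero =>
    simp only [Function.iterate_zero, id, stateIndicator]
    by_cases hc : c = k ∧ a = 0
    · obtain ⟨rfl, rfl⟩ := hc
      simp [reducedStirling, pqAscFactorial_zero]
    · rw [if_neg hc]
      split_ifs with h
      · obtain ⟨d, hd⟩ : ∃ d, k - c = d + 1 := ⟨k - c - 1, by omega⟩
        simp [hd, reducedStirling]
      · rfl
  | succ n ih =>
    -- The outermost application is the first step of the path, so the induction runs over start
    -- states with the end (k, 0) fixed.
    rw [Function.iterate_succ_apply']
    simp only [transfer]
    rw [ih, ih, ih, ih]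
    obtain h | h := le_or_gt (c + a) k
    · obtain ⟨u, rfl⟩ := Nat.exists_eq_add_of_le h
      rw [if_pos h]
      obtain _ | u := u <;> obtain _ | a := a
      · simp [pqNumber_zero, reducedStirling]
      · have e1 : c + (a + 1) - (c + 1) = a := by omega
        have e2 : c + 1 + (a + 1 - 1) ≤ c + (a + 1) := by omega
        have e3 : c + (a + 1) - (c + 1 + (a + 1 - 1)) = 0 := by omega
        -- No block is left to open: both opening steps leave the region c + a ≤ k, so the truncated
        -- exponent of their weight is irrelevant.
        have e4 : ¬ c + 1 + (a + 1) ≤ c + (a + 1) := by omega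
        have e5 : ¬ c + (a + 1 + 1) ≤ c + (a + 1) := by omega
        have e6 : c + (a + 1) - c = a + 1 := by omega
        rw [add_zero, if_pos le_rfl, if_pos e2, if_neg e5, if_neg e4, e1, e3, e6,
          Nat.sub_self, Nat.add_sub_cancel, reducedStirling, pqAscFactorial_succ, zero_add]
        simp
        ring
      · have e2 : c + (u + 1) - c = u + 1 := by omega
        have e3 : c + (u + 1) - (c + 1) = u := by omega
        have e4 : c + 1 ≤ c + (u + 1) := by omega
        simp [e2, e3, e4, reducedStirling, pqAscFactorial_succ, pqNumber_zero,
          pqAscFactorial_zero, choose_two_succ, pow_add]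
        ring
      · have e0 := pqNumber_add p q (u + 1) (a + 1)
        have e1 : c + (a + 1) + (u + 1) - c = u + a + 1 + 1 := by omega
        have e2 : c + (a + 1) + (u + 1) - (c + (a + 1)) = u + 1 := by omega
        have e3 : c + (a + 1) + (u + 1) - (c + 1) = u + a + 1 := by omega
        have e4 : c + (a + 1) + (u + 1) - (c + 1 + (a + 1 - 1)) = u + 1 := by omega
        have e5 : c + (a + 1) + (u + 1) - (c + (a + 1 + 1)) = u := by omega
        have e6 : c + (a + 1) + (u + 1) - (c + 1 + (a + 1)) = u := by omega
        have e7 : c + (a + 1) + (u + 1) - (c + (a + 1) + 1) = u := by omega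
        rw [if_pos (by omega), if_pos (by omega), if_pos (by omega), if_pos (by omega),
          e1, e2, e3, e4, e5, e6, e7, reducedStirling, Nat.add_sub_cancel,
          pqAscFactorial_succ' p q u (a + 1), pqAscFactorial_succ' p q u a,
          pqAscFactorial_succ p q (u + 1) a, show u + 1 + a + 1 = u + a + 1 + 1 by omega,
          choose_two_succ u]
        rw [show u + 1 + (a + 1) = u + a + 1 + 1 by omega] at e0
        rw [e0]
        ring
    · rw [if_neg (by omega), if_neg (by omega), if_neg (by omega), if_neg (by omega)]
      rw [if_neg (by omega)]
      obtain _ | a := a <;> simp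

theorem pathSum_mak' (n k : ℕ) :
    pathSum p q (fun c a => p ^ (k - (c + a + 1)) * q ^ a) (fun c a => p ^ (k - (c + a))) n k 0 =
      pqStirling p q n k := by
  rw [pathSum, transfer_iterate_stateIndicator, pqStirling_eq]
  simp [pqAscFactorial_zero]

/-! ### Specialisations p = 1 and q = 1. -/

theorem pqNumber_one_right (m : ℕ) : pqNumber q 1 m = qNumber q m := by
  simp only [pqNumber, qNumber, one_pow, mul_one]
  exact Finset.sum_range_reflect (fun i => q ^ i) m

theorem pqNumber_one_left (m : ℕ) : pqNumber 1 q m = qNumber q m := by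
  simp [pqNumber, qNumber]

theorem pqFactorial_one_right (k : ℕ) : pqFactorial q 1 k = qFactorial q k := by
  simp [pqFactorial, qFactorial, pqNumber_one_right]

theorem pqFactorial_one_left (k : ℕ) : pqFactorial 1 q k = qFactorial q k := by
  simp [pqFactorial, qFactorial, pqNumber_one_left]

/-- The recursion involves p and q only through [m]_{p,q}, and [m]_{1,q} = [m]_{q,1}. -/
theorem reducedStirling_one_left (n m : ℕ) :
    reducedStirling 1 q n m = reducedStirling q 1 n m := by
  induction n generalizing m with
  | zero => obtain _ | m := m <;> simp [reducedStirling]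
  | succ n ih =>
    obtain _ | m := m
    · simp [reducedStirling]
    · simp [reducedStirling, ih, pqNumber_one_left, pqNumber_one_right]

theorem pow_mul_pqStirling_one_left (n k : ℕ) :
    q ^ k.choose 2 * pqStirling 1 q n k = qStirling q n k := by
  rw [qStirling, pqStirling_eq, pqStirling_eq, reducedStirling_one_left]
  simp

end Algebra

/-! ### Weights of words and their summation over labels. -/

section Words

variable {κ : Type*} [LinearOrder κ]

section SubsetSums

variable {R : Type*} [CommSemiring R]

/-- An element with r smaller ones in S contributes p^(|S|-1-r) q^r. -/
theorem sum_pow_card_filter (p q : R) (S : Finset κ) :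
    ∑ b ∈ S, p ^ (S.filter (b < ·)).card * q ^ (S.filter (· < b)).card = pqNumber p q S.card := by
  induction S using Finset.induction_on_max with
  | empty => simp [pqNumber_zero]
  | insert m S hm ih =>
    have hmS : m ∉ S := fun h => lt_irrefl _ (hm m h)
    rw [Finset.sum_insert hmS, Finset.card_insert_of_notMem hmS, add_comm S.card 1, pqNumber_add,
      ← ih, pow_one, pqNumber_one, mul_one, add_comm, Finset.mul_sum]
    congr 1
    · refine Finset.sum_congr rfl fun b hb => ?_
      rw [Finset.filter_insert, Finset.filter_insert, if_pos (hm b hb),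
        if_neg (hm b hb).not_gt, Finset.card_insert_of_notMem (by simp [hmS]), pow_succ]
      ring
    · rw [Finset.filter_insert, Finset.filter_insert, if_neg (lt_irrefl m), if_neg (lt_irrefl m),
        Finset.filter_false_of_mem fun b hb => (hm b hb).not_gt, Finset.filter_true_of_mem hm]
      simp

/-- Used for a last letter joining b: either b ∈ A stays active, or b ∉ A is closed by that letter
and `insert b A` was the active set before it. -/
theorem sum_powersetCard_insert (O : Finset κ) (a : ℕ) (g : Finset κ → κ → R) :
    ∑ A ∈ O.powersetCard a, ∑ b ∈ O, g (insert b A) b =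
      ∑ A ∈ O.powersetCard a, ∑ b ∈ A, g A b + ∑ A ∈ O.powersetCard (a + 1), ∑ b ∈ A, g A b := by
  have h : ∑ A ∈ O.powersetCard a, ∑ b ∈ O, g (insert b A) b =
      ∑ A ∈ O.powersetCard a, ∑ b ∈ A, g A b +
        ∑ A ∈ O.powersetCard a, ∑ b ∈ O \ A, g (insert b A) b := by
    rw [← Finset.sum_add_distrib]
    refine Finset.sum_congr rfl fun A hA => ?_
    rw [← Finset.sum_sdiff (Finset.mem_powersetCard.mp hA).1, add_comm]
    congr 1
    exact Finset.sum_congr rfl fun b hb => by rw [Finset.insert_eq_of_mem hb]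
  rw [h]
  congr 1
  rw [Finset.sum_sigma', Finset.sum_sigma']
  refine Finset.sum_bij' (fun x _ => ⟨insert x.2 x.1, x.2⟩) (fun x _ => ⟨x.1.erase x.2, x.2⟩)
    ?_ ?_ ?_ ?_ ?_
  · rintro ⟨A, b⟩ hx
    simp only [Finset.mem_sigma, Finset.mem_powersetCard, Finset.mem_sdiff] at hx ⊢
    obtain ⟨⟨h1, h2⟩, h3, h4⟩ := hx
    exact ⟨⟨Finset.insert_subset h3 h1, by rw [Finset.card_insert_of_notMem h4, h2]⟩,
      Finset.mem_insert_self _ _⟩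
  · rintro ⟨A, b⟩ hx
    simp only [Finset.mem_sigma, Finset.mem_powersetCard, Finset.mem_sdiff] at hx ⊢
    obtain ⟨⟨h1, h2⟩, h3⟩ := hx
    exact ⟨⟨(Finset.erase_subset _ _).trans h1, by rw [Finset.card_erase_of_mem h3, h2]; rfl⟩,
      h1 h3, Finset.notMem_erase _ _⟩
  · rintro ⟨A, b⟩ hx
    simp only [Finset.mem_sigma, Finset.mem_sdiff] at hx
    simp [Finset.erase_insert hx.2.2]
  · rintro ⟨A, b⟩ hx
    simp only [Finset.mem_sigma] at hx
    simp [Finset.insert_erase hx.2]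
  · rintro ⟨A, b⟩ _
    rfl

/-- Used for a last letter opening b: the first sum collects the A without b (a singleton block,
closed at once), the second those with b (kept active). -/
theorem sum_powersetCard_erase {O : Finset κ} {b : κ} (hb : b ∈ O) (a : ℕ) (g : Finset κ → R) :
    ∑ A ∈ O.powersetCard (a + 1), g (A.erase b) =
      ∑ A ∈ (O.erase b).powersetCard (a + 1), g A + ∑ A ∈ (O.erase b).powersetCard a, g A := by
  have hnot : ∀ {m : ℕ} {A : Finset κ}, A ∈ (O.erase b).powersetCard m → b ∉ A := fun hA h =>
    Finset.notMem_erase b O ((Finset.mem_powersetCard.mp hA).1 h)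
  conv_lhs => rw [← Finset.insert_erase hb]
  rw [Finset.powersetCard_succ_insert (Finset.notMem_erase b O), Finset.sum_union,
    Finset.sum_image]
  · congr 1
    · exact Finset.sum_congr rfl fun A hA => by rw [Finset.erase_eq_of_notMem (hnot hA)]
    · exact Finset.sum_congr rfl fun A hA => by rw [Finset.erase_insert (hnot hA)]
  · intro A hA A' hA' h
    rw [← Finset.erase_insert (hnot hA), ← Finset.erase_insert (hnot hA'), h]
  · refine Finset.disjoint_left.mpr fun A hA hA' => hnot hA ?_
    obtain ⟨A', -, rfl⟩ := Finset.mem_image.mp hA'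
    exact Finset.mem_insert_self _ _

end SubsetSums

/-- The letters (blocks) occurring in `w` before position `i`. -/
def openedBefore {n : ℕ} (w : Fin n → κ) (i : Fin n) : Finset κ :=
  (Finset.univ.filter (· < i)).image w

/-- The letters (blocks) occurring in `w` before position `i` that occur again at or after `i`, or
belong to the set `A` of blocks that stay active after the whole word. -/
def activeBefore {n : ℕ} (w : Fin n → κ) (A : Finset κ) (i : Fin n) : Finset κ :=
  (openedBefore w i).filter fun b => b ∈ A ∨ ∃ j, i ≤ j ∧ w j = b

theorem openedBefore_snoc_castSucc {n : ℕ} (w : Fin n → κ) (b : κ) (i : Fin n) :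
    openedBefore (Fin.snoc w b : Fin (n + 1) → κ) i.castSucc = openedBefore w i := by
  ext x
  simp only [openedBefore, Finset.mem_image, Finset.mem_filter, Finset.mem_univ, true_and]
  constructor
  · rintro ⟨j, hj, rfl⟩
    obtain ⟨j, rfl⟩ := Fin.eq_castSucc_of_ne_last (hj.trans (Fin.castSucc_lt_last i)).ne
    exact ⟨j, by simpa using hj, by simp⟩
  · rintro ⟨j, hj, rfl⟩
    exact ⟨j.castSucc, by simpa using hj, by simp⟩

theorem openedBefore_snoc_last {n : ℕ} (w : Fin n → κ) (b : κ) :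
    openedBefore (Fin.snoc w b : Fin (n + 1) → κ) (Fin.last n) = Finset.univ.image w := by
  ext x
  simp only [openedBefore, Finset.mem_image, Finset.mem_filter, Finset.mem_univ, true_and]
  constructor
  · rintro ⟨j, hj, rfl⟩
    obtain ⟨j, rfl⟩ := Fin.eq_castSucc_of_ne_last hj.ne
    exact ⟨j, by simp⟩
  · rintro ⟨j, rfl⟩
    exact ⟨j.castSucc, Fin.castSucc_lt_last j, by simp⟩

/-- Seen from an earlier position, a final letter b keeps b active; deleting it therefore moves b
into A. -/
theorem activeBefore_snoc_castSucc {n : ℕ} (w : Fin n → κ) (A : Finset κ) (b : κ) (i : Fin n) :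
    activeBefore (Fin.snoc w b : Fin (n + 1) → κ) A i.castSucc =
      activeBefore w (insert b A) i := by
  unfold activeBefore
  rw [openedBefore_snoc_castSucc]
  refine Finset.filter_congr fun x _ => ?_
  rw [Fin.exists_fin_succ']
  simp only [Fin.castSucc_le_castSucc_iff, Fin.snoc_castSucc, Fin.snoc_last, Finset.mem_insert,
    Fin.le_last, true_and, eq_comm (a := x)]
  grind

theorem activeBefore_snoc_last {n : ℕ} (w : Fin n → κ) (A : Finset κ) (b : κ) :
    activeBefore (Fin.snoc w b : Fin (n + 1) → κ) A (Fin.last n) =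
      insert b A ∩ Finset.univ.image w := by
  unfold activeBefore
  rw [openedBefore_snoc_last]
  ext x
  rw [Finset.mem_filter, Fin.exists_fin_succ']
  simp only [Finset.mem_inter, Finset.mem_insert, Fin.le_last, Fin.snoc_last, true_and,
    Fin.last_le_iff, Fin.castSucc_ne_last, false_and, exists_false, false_or, eq_comm (a := x)]
  tauto

theorem activeBefore_congr {n : ℕ} (w : Fin n → κ) {A A' : Finset κ}
    (h : A ∩ Finset.univ.image w = A' ∩ Finset.univ.image w) (i : Fin n) :
    activeBefore w A i = activeBefore w A' i := by
  refine Finset.filter_congr fun x hx => or_congr_left ?_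
  obtain ⟨j, -, rfl⟩ := Finset.mem_image.mp hx
  simpa using congr(w j ∈ $h)

theorem image_snoc {n : ℕ} (w : Fin n → κ) (b : κ) :
    Finset.univ.image (Fin.snoc w b : Fin (n + 1) → κ) = insert b (Finset.univ.image w) := by
  ext x
  simp only [Finset.mem_image, Finset.mem_univ, true_and, Finset.mem_insert]
  rw [Fin.exists_fin_succ']
  simp only [Fin.snoc_castSucc, Fin.snoc_last, eq_comm (a := x)]
  tauto

variable {R : Type*} [CommSemiring R] (p q : R) (α β : ℕ → ℕ → R)

/-- The weight of a letter in the block `b`, when the blocks in `O` are opened and those in `A` are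
active. -/
def letterWeight (O A : Finset κ) (b : κ) : R :=
  if b ∈ O then
    β (O \ A).card A.card * (p ^ (A.filter (b < ·)).card * q ^ (A.filter (· < b)).card)
  else
    α (O \ A).card A.card * q ^ O.card *
      (p ^ (O.filter (b < ·)).card * q ^ (O.filter (· < b)).card)

/-- The weight of a word all of whose blocks are closed, except those in `A`. -/
def wordWeight {n : ℕ} (w : Fin n → κ) (A : Finset κ) : R :=
  ∏ i, letterWeight p q α β (openedBefore w i) (activeBefore w A i) (w i)

theorem wordWeight_snoc {n : ℕ} (w : Fin n → κ) (A : Finset κ) (b : κ) :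
    wordWeight p q α β (Fin.snoc w b : Fin (n + 1) → κ) A =
      wordWeight p q α β w (insert b A) *
        letterWeight p q α β (Finset.univ.image w) (insert b A ∩ Finset.univ.image w) b := by
  unfold wordWeight
  rw [Fin.prod_univ_castSucc]
  simp only [openedBefore_snoc_castSucc, activeBefore_snoc_castSucc, openedBefore_snoc_last,
    activeBefore_snoc_last, Fin.snoc_castSucc, Fin.snoc_last]

theorem wordWeight_congr {n : ℕ} (w : Fin n → κ) {A A' : Finset κ}
    (h : A ∩ Finset.univ.image w = A' ∩ Finset.univ.image w) :
    wordWeight p q α β w A = wordWeight p q α β w A' := by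
  simp only [wordWeight, activeBefore_congr w h]

variable [Fintype κ]

/-- The total weight of the words of length `n` in the blocks in `O`. -/
def stateSum (n : ℕ) (O A : Finset κ) : R :=
  ∑ w : Fin n → κ with Finset.univ.image w = O, wordWeight p q α β w A

theorem stateSum_zero (O A : Finset κ) :
    stateSum p q α β 0 O A = if O = ∅ then 1 else 0 := by
  unfold stateSum
  rw [Finset.sum_filter, Fintype.sum_unique]
  simp [wordWeight, eq_comm]

/-- Delete the last letter b. The shorter word either still uses all of O, or has lost b because
that letter opened its block. -/
theorem stateSum_succ (n : ℕ) {O A : Finset κ} (hA : A ⊆ O) :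
    stateSum p q α β (n + 1) O A =
      ∑ b ∈ O, (stateSum p q α β n O (insert b A) * letterWeight p q α β O (insert b A) b +
        stateSum p q α β n (O.erase b) (A.erase b) *
          letterWeight p q α β (O.erase b) (A.erase b) b) := by
  unfold stateSum
  rw [Finset.sum_filter, ← (Fin.snocEquiv fun _ => κ).sum_comp, Fintype.sum_prod_type]
  have hO : ∀ b, b ∉ O → ∑ w : Fin n → κ, (if Finset.univ.image
      (Fin.snoc w b : Fin (n + 1) → κ) = O then
        wordWeight p q α β (Fin.snoc w b : Fin (n + 1) → κ) A else 0) = 0 := by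
    intro b hb
    refine Finset.sum_eq_zero fun w _ => if_neg fun h => hb ?_
    rw [← h, image_snoc]
    exact Finset.mem_insert_self _ _
  refine (Finset.sum_subset (Finset.subset_univ O) fun b _ hb => hO b hb).symm.trans ?_
  refine Finset.sum_congr rfl fun b hb => ?_
  rw [Finset.sum_mul, Finset.sum_mul, Finset.sum_filter, Finset.sum_filter,
    ← Finset.sum_add_distrib]
  refine Finset.sum_congr rfl fun w _ => ?_
  have hne : O ≠ O.erase b := fun h => Finset.notMem_erase b O (h ▸ hb)
  change (if Finset.univ.image (Fin.snoc w b : Fin (n + 1) → κ) = O then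
        wordWeight p q α β (Fin.snoc w b : Fin (n + 1) → κ) A else 0) = _
  rw [image_snoc, wordWeight_snoc]
  by_cases h1 : Finset.univ.image w = O
  · rw [h1, if_pos (Finset.insert_eq_of_mem hb), if_pos rfl, if_neg hne, add_zero,
      Finset.inter_eq_left.mpr (Finset.insert_subset hb hA)]
  · rw [if_neg h1, zero_add]
    by_cases h2 : Finset.univ.image w = O.erase b
    · have h3 : insert b A ∩ O.erase b = A.erase b := by
        ext x
        have := @hA x
        simp only [Finset.mem_inter, Finset.mem_insert, Finset.mem_erase]
        tauto
      rw [if_pos h2, h2, if_pos (Finset.insert_erase hb), h3]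
      -- As b does not occur in w, `insert b A` and `A.erase b` select the same active blocks.
      congr 1
      refine wordWeight_congr p q α β w ?_
      rw [h2, h3, Finset.inter_eq_left.mpr (Finset.erase_subset_erase b hA)]
    · rw [if_neg h2, if_neg]
      intro h
      by_cases hbw : b ∈ Finset.univ.image w
      · exact h1 ((Finset.insert_eq_of_mem hbw).symm.trans h)
      · exact h2 (by rw [← h, Finset.erase_insert hbw])

theorem sum_stateSum_join (n a c : ℕ) {O : Finset κ} (hO : O.card = c + a) :
    ∑ A ∈ O.powersetCard a, ∑ b ∈ A,
      stateSum p q α β n O A * letterWeight p q α β O A b =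
      β c a * pqNumber p q a * ∑ A ∈ O.powersetCard a, stateSum p q α β n O A := by
  rw [Finset.mul_sum]
  refine Finset.sum_congr rfl fun A hA => ?_
  obtain ⟨hAO, rfl⟩ := Finset.mem_powersetCard.mp hA
  have hc : (O \ A).card = c := by rw [Finset.card_sdiff_of_subset hAO, hO, Nat.add_sub_cancel]
  rw [← sum_pow_card_filter, Finset.mul_sum, Finset.sum_mul]
  refine Finset.sum_congr rfl fun b hb => ?_
  rw [letterWeight, if_pos (hAO hb), hc]
  ring

theorem sum_stateSum_open (n a c : ℕ) {O : Finset κ} (hO : O.card = c + a + 1) {b : κ}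
    (hb : b ∈ O) {x : R}
    (hx : ∑ A ∈ (O.erase b).powersetCard a, stateSum p q α β n (O.erase b) A = x) :
    ∑ A ∈ (O.erase b).powersetCard a, stateSum p q α β n (O.erase b) A *
      letterWeight p q α β (O.erase b) A b =
      (p ^ (O.filter (b < ·)).card * q ^ (O.filter (· < b)).card) *
        (α c a * q ^ (c + a) * x) := by
  rw [← hx, Finset.mul_sum, Finset.mul_sum]
  refine Finset.sum_congr rfl fun A hA => ?_
  obtain ⟨hAO, rfl⟩ := Finset.mem_powersetCard.mp hA
  have hO' : (O.erase b).card = c + A.card := by rw [Finset.card_erase_of_mem hb, hO]; rfl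
  have hc : (O.erase b \ A).card = c := by
    rw [Finset.card_sdiff_of_subset hAO, hO', Nat.add_sub_cancel]
  have h1 : (O.erase b).filter (b < ·) = O.filter (b < ·) := by
    ext x
    simp only [Finset.mem_filter, Finset.mem_erase]
    exact ⟨fun h => ⟨h.1.2, h.2⟩, fun h => ⟨⟨h.2.ne', h.1⟩, h.2⟩⟩
  have h2 : (O.erase b).filter (· < b) = O.filter (· < b) := by
    ext x
    simp only [Finset.mem_filter, Finset.mem_erase]
    exact ⟨fun h => ⟨h.1.2, h.2⟩, fun h => ⟨⟨h.2.ne, h.1⟩, h.2⟩⟩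
  rw [letterWeight, if_neg (Finset.notMem_erase b O), hc, h1, h2, hO']
  ring

/-- A single `stateSum` depends on the labels; only after summing over all A of a given size do
ranks collapse to p,q-numbers, so that the sum depends on c and a alone and follows `pathSum_succ`.
-/
theorem sum_stateSum (n c a : ℕ) {O : Finset κ} (hO : O.card = c + a) :
    ∑ A ∈ O.powersetCard a, stateSum p q α β n O A =
      pqFactorial p q (c + a) * q ^ (c + a).choose 2 * pathSum p q α β n c a := by
  induction n generalizing c a O with
  | zero =>
    simp only [stateSum_zero, pathSum_zero]
    obtain rfl | hne := O.eq_empty_or_nonempty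
    · obtain ⟨rfl, rfl⟩ : c = 0 ∧ a = 0 := by simpa [eq_comm] using hO
      simp [pqFactorial]
    · have hpos := hne.card_pos
      rw [if_neg (c := c = 0 ∧ a = 0) (by omega), mul_zero]
      simp [hne.ne_empty]
  | succ n ih =>
    have hsplit : ∑ A ∈ O.powersetCard a, stateSum p q α β (n + 1) O A =
        (∑ A ∈ O.powersetCard a, ∑ b ∈ A,
          stateSum p q α β n O A * letterWeight p q α β O A b +
        ∑ A ∈ O.powersetCard (a + 1), ∑ b ∈ A,
          stateSum p q α β n O A * letterWeight p q α β O A b) +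
        ∑ b ∈ O, ∑ A ∈ O.powersetCard a, stateSum p q α β n (O.erase b) (A.erase b) *
          letterWeight p q α β (O.erase b) (A.erase b) b := by
      rw [← sum_powersetCard_insert O a fun A b =>
        stateSum p q α β n O A * letterWeight p q α β O A b, Finset.sum_comm (s := O),
        ← Finset.sum_add_distrib]
      refine Finset.sum_congr rfl fun A hA => ?_
      rw [stateSum_succ p q α β n (Finset.mem_powersetCard.mp hA).1, Finset.sum_add_distrib]
    have hclose : ∑ A ∈ O.powersetCard (a + 1), ∑ b ∈ A,
          stateSum p q α β n O A * letterWeight p q α β O A b =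
        pqFactorial p q (c + a) * q ^ (c + a).choose 2 * pathSumClose p q α β n c a := by
      obtain _ | c := c
      · rw [Finset.powersetCard_eq_empty.mpr (by omega)]
        simp [pathSumClose]
      · have hO' : O.card = c + (a + 1) := by omega
        rw [sum_stateSum_join p q α β n (a + 1) c hO', ih c (a + 1) hO', pathSumClose,
          show c + 1 + a = c + (a + 1) by omega]
        ring
    have hopen : ∑ b ∈ O, ∑ A ∈ O.powersetCard a,
          stateSum p q α β n (O.erase b) (A.erase b) *
            letterWeight p q α β (O.erase b) (A.erase b) b =
        pqFactorial p q (c + a) * q ^ (c + a).choose 2 * pathSumOpen p q α β n c a := by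
      have hcard : ∀ b ∈ O, (O.erase b).card = c + a - 1 := fun b hb => by
        rw [Finset.card_erase_of_mem hb, hO]
      have hconst : ∀ y : R, (∀ b ∈ O, ∑ A ∈ O.powersetCard a,
          stateSum p q α β n (O.erase b) (A.erase b) *
            letterWeight p q α β (O.erase b) (A.erase b) b =
          (p ^ (O.filter (b < ·)).card * q ^ (O.filter (· < b)).card) * y) →
          ∑ b ∈ O, ∑ A ∈ O.powersetCard a,
          stateSum p q α β n (O.erase b) (A.erase b) *
            letterWeight p q α β (O.erase b) (A.erase b) b = pqNumber p q (c + a) * y := by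
        intro y hy
        rw [Finset.sum_congr rfl hy, ← Finset.sum_mul, sum_pow_card_filter, hO]
      obtain _ | c := c <;> obtain _ | a := a
      · obtain rfl := Finset.card_eq_zero.mp hO
        simp [pathSumOpen]
      · rw [hconst (α 0 a * q ^ (0 + a) *
          (pqFactorial p q (0 + a) * q ^ (0 + a).choose 2 * pathSum p q α β n 0 a))]
        · rw [pathSumOpen, ← add_assoc, pqFactorial_succ, choose_two_succ]
          ring
        · intro b hb
          -- With c = 0 a singleton is impossible: the first sum is over (a+1)-subsets of the
          -- a-element set `O.erase b`.
          rw [sum_powersetCard_erase hb a fun A => stateSum p q α β n (O.erase b) A *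
            letterWeight p q α β (O.erase b) A b,
            Finset.powersetCard_eq_empty.mpr (by rw [hcard b hb]; omega), Finset.sum_empty,
            zero_add]
          exact sum_stateSum_open p q α β n a 0 hO hb (ih 0 a (hcard b hb))
      · rw [hconst (α c 0 * q ^ (c + 0) *
          (pqFactorial p q (c + 0) * q ^ (c + 0).choose 2 * pathSum p q α β n c 0))]
        · rw [pathSumOpen, add_zero, add_zero, pqFactorial_succ, choose_two_succ]
          ring
        · intro b hb
          rw [← sum_stateSum_open p q α β n 0 c (by omega) hb (ih c 0 (by simp [hcard b hb]))]
          simp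
      · have h1 := fun b (hb : b ∈ O) => ih (O := O.erase b) c (a + 1)
          (by rw [hcard b hb]; omega)
        have h2 := fun b (hb : b ∈ O) => ih (O := O.erase b) (c + 1) a
          (by rw [hcard b hb]; omega)
        rw [hconst (α c (a + 1) * q ^ (c + (a + 1)) *
          (pqFactorial p q (c + (a + 1)) * q ^ (c + (a + 1)).choose 2 *
            pathSum p q α β n c (a + 1)) + α (c + 1) a * q ^ (c + 1 + a) *
          (pqFactorial p q (c + 1 + a) * q ^ (c + 1 + a).choose 2 *
            pathSum p q α β n (c + 1) a))]
        · rw [pathSumOpen, show c + 1 + (a + 1) = c + a + 1 + 1 by omega, pqFactorial_succ,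
            choose_two_succ (c + a + 1), show c + 1 + a = c + a + 1 by omega, ← add_assoc c a 1]
          ring
        · intro b hb
          rw [sum_powersetCard_erase hb a fun A => stateSum p q α β n (O.erase b) A *
            letterWeight p q α β (O.erase b) A b, mul_add,
            ← sum_stateSum_open p q α β n (a + 1) c (by omega) hb (h1 b hb),
            ← sum_stateSum_open p q α β n a (c + 1) (by omega) hb (h2 b hb)]
    rw [hsplit, sum_stateSum_join p q α β n a c hO, ih c a hO, hclose, hopen, pathSum_succ]
    ring

theorem sum_wordWeight (n : ℕ) :
    ∑ w : Fin n → κ with Finset.univ.image w = Finset.univ, wordWeight p q α β w ∅ =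
      q ^ (Fintype.card κ).choose 2 * pqFactorial p q (Fintype.card κ) *
        pathSum p q α β n (Fintype.card κ) 0 := by
  have h := sum_stateSum p q α β n (Fintype.card κ) 0 (O := (Finset.univ : Finset κ)) rfl
  rw [Finset.powersetCard_zero, Finset.sum_singleton, add_zero] at h
  rw [mul_comm (q ^ _), ← h]
  rfl

end Words

theorem sum_card_filter_lt {κ : Type*} [LinearOrder κ] (S : Finset κ) :
    ∑ b ∈ S, (S.filter (· < b)).card = S.card.choose 2 := by
  induction S using Finset.induction_on_max with
  | empty => simp
  | insert m S hm ih =>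
    have hmS : m ∉ S := fun h => lt_irrefl _ (hm m h)
    rw [Finset.sum_insert hmS, Finset.card_insert_of_notMem hmS, choose_two_succ, ← ih]
    congr 1
    · rw [Finset.filter_insert, if_neg (lt_irrefl m), Finset.filter_true_of_mem hm]
    · refine Finset.sum_congr rfl fun b hb => ?_
      rw [Finset.filter_insert, if_neg (hm b hb).not_gt]

theorem card_filter_lt_add_card_filter_gt {κ : Type*} [LinearOrder κ] {S : Finset κ} {b : κ}
    (hb : b ∉ S) : (S.filter (· < b)).card + (S.filter (b < ·)).card = S.card := by
  rw [← Finset.card_filter_add_card_filter_not (s := S) (· < b)]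
  congr 2
  refine Finset.filter_congr fun x hx => ?_
  have : x ≠ b := fun h => hb (h ▸ hx)
  rw [not_lt]
  exact ⟨le_of_lt, fun h => lt_of_le_of_ne h this.symm⟩

/-! ### Localising the statistics at the letters of the word. -/

namespace OrderedSetPartition

variable {n k : ℕ} (π : OrderedSetPartition n k)

theorem idx_eq_iff {i : Fin n} {b : Fin k} : π.idx i = b ↔ i ∈ π.block b := by
  constructor
  · rintro rfl
    exact π.mem_block_idx i
  · intro h
    exact (π.existsUnique_mem_block i).unique ⟨Finset.mem_univ _, π.mem_block_idx i⟩
      ⟨Finset.mem_univ _, h⟩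

theorem idx_opener (b : Fin k) : π.idx (π.opener b) = b :=
  π.idx_eq_iff.mpr (Finset.min'_mem _ _)

theorem idx_closer (b : Fin k) : π.idx (π.closer b) = b :=
  π.idx_eq_iff.mpr (Finset.max'_mem _ _)

theorem opener_idx_le (i : Fin n) : π.opener (π.idx i) ≤ i :=
  Finset.min'_le _ _ (π.mem_block_idx i)

theorem le_closer_idx (i : Fin n) : i ≤ π.closer (π.idx i) :=
  Finset.le_max' _ _ (π.mem_block_idx i)

theorem opener_injective : Function.Injective π.opener :=
  Function.LeftInverse.injective π.idx_opener

theorem closer_injective : Function.Injective π.closer :=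
  Function.LeftInverse.injective π.idx_closer

theorem opener_le_closer (b : Fin k) : π.opener b ≤ π.closer b := by
  simpa [idx_closer] using π.opener_idx_le (π.closer b)

theorem image_idx : Finset.univ.image π.idx = Finset.univ :=
  Finset.eq_univ_of_forall fun b =>
    Finset.mem_image.mpr ⟨π.opener b, Finset.mem_univ _, π.idx_opener b⟩

theorem mem_openedBefore {i : Fin n} {b : Fin k} :
    b ∈ openedBefore π.idx i ↔ π.opener b < i := by
  simp only [openedBefore, Finset.mem_image, Finset.mem_filter, Finset.mem_univ, true_and]
  constructor
  · rintro ⟨j, hj, rfl⟩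
    exact (π.opener_idx_le j).trans_lt hj
  · exact fun h => ⟨_, h, π.idx_opener b⟩

theorem mem_activeBefore {i : Fin n} {b : Fin k} :
    b ∈ activeBefore π.idx ∅ i ↔ π.opener b < i ∧ i ≤ π.closer b := by
  rw [activeBefore, Finset.mem_filter, mem_openedBefore]
  refine and_congr_right fun _ => ?_
  simp only [Finset.notMem_empty, false_or]
  constructor
  · rintro ⟨j, hj, rfl⟩
    exact hj.trans (π.le_closer_idx j)
  · exact fun h => ⟨_, h, π.idx_closer b⟩

/-- The blocks closed before `i`. -/
def closedBefore (i : Fin n) : Finset (Fin k) :=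
  openedBefore π.idx i \ activeBefore π.idx ∅ i

theorem mem_closedBefore {i : Fin n} {b : Fin k} :
    b ∈ π.closedBefore i ↔ π.closer b < i := by
  rw [closedBefore, Finset.mem_sdiff, mem_openedBefore, mem_activeBefore]
  have := π.opener_le_closer b
  constructor
  · rintro ⟨h1, h2⟩
    exact lt_of_not_ge fun h => h2 ⟨h1, h⟩
  · exact fun h => ⟨this.trans_lt h, fun h' => h.not_ge h'.2⟩

theorem idx_notMem_closedBefore (i : Fin n) : π.idx i ∉ π.closedBefore i := by
  rw [mem_closedBefore, not_lt]
  exact π.le_closer_idx i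

theorem card_closedBefore_add_card_activeBefore (i : Fin n) :
    (π.closedBefore i).card + (activeBefore π.idx ∅ i).card = (openedBefore π.idx i).card :=
  Finset.card_sdiff_add_card_eq_card (Finset.filter_subset _ _)

theorem card_filter_openedBefore (i : Fin n) (P : Fin k → Prop) [DecidablePred P] :
    ((openedBefore π.idx i).filter P).card =
      ((π.closedBefore i).filter P).card + ((activeBefore π.idx ∅ i).filter P).card := by
  rw [closedBefore, ← Finset.card_union_of_disjoint, ← Finset.filter_union,
    Finset.sdiff_union_of_subset (show activeBefore π.idx ∅ i ⊆ openedBefore π.idx i from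
      Finset.filter_subset _ _)]
  exact Finset.disjoint_filter_filter Finset.sdiff_disjoint

theorem card_filter_openers (P : Fin n → Prop) [DecidablePred P] :
    (π.openers.filter P).card = (Finset.univ.filter fun b => P (π.opener b)).card := by
  rw [openers, Finset.filter_image, Finset.card_image_of_injective _ π.opener_injective]

theorem card_filter_closers (P : Fin n → Prop) [DecidablePred P] :
    (π.closers.filter P).card = (Finset.univ.filter fun b => P (π.closer b)).card := by
  rw [closers, Finset.filter_image, Finset.card_image_of_injective _ π.closer_injective]

theorem rosAt_eq (i : Fin n) :
    π.rosAt i = ((openedBefore π.idx i).filter (π.idx i < ·)).card := by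
  rw [rosAt, card_filter_openers]
  congr 1
  ext b
  simp [idx_opener, mem_openedBefore]

theorem lcsAt_eq (i : Fin n) : π.lcsAt i = ((π.closedBefore i).filter (· < π.idx i)).card := by
  rw [lcsAt, card_filter_closers]
  congr 1
  ext b
  simp [idx_closer, mem_closedBefore]

/-- Active allows i to be the closer of b, but then b is the block of i, which the condition b <
`π.idx i` excludes. -/
theorem lsbAt_eq (i : Fin n) :
    π.lsbAt i = ((activeBefore π.idx ∅ i).filter (· < π.idx i)).card := by
  rw [lsbAt]
  congr 1
  ext b
  simp only [Finset.mem_filter, Finset.mem_univ, true_and, mem_activeBefore]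
  constructor
  · exact fun h => ⟨⟨h.2.1, h.2.2.le⟩, h.1⟩
  · refine fun h => ⟨h.2, h.1.1, lt_of_le_of_ne h.1.2 fun hi => h.2.ne ?_⟩
    rw [hi, idx_closer]

/-- Each closed block is counted once, by `ros` if on the right and by `lcs` if on the left; active
blocks are seen only by `ros`. -/
theorem rosAt_add_lcsAt (i : Fin n) :
    π.rosAt i + π.lcsAt i = (π.closedBefore i).card +
      ((activeBefore π.idx ∅ i).filter (π.idx i < ·)).card := by
  rw [rosAt_eq, lcsAt_eq, card_filter_openedBefore,
    ← card_filter_lt_add_card_filter_gt (π.idx_notMem_closedBefore i)]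
  ring

/-- Each block opening after i is counted once, by `lob` on the left or `rcb` on the right; active
blocks are seen only by `rcb`. The `insert` excludes the block that i itself may open. -/
theorem lobAt_add_rcbAt (i : Fin n) :
    π.lobAt i + π.rcbAt i = (k - (insert (π.idx i) (openedBefore π.idx i)).card) +
      ((activeBefore π.idx ∅ i).filter (π.idx i < ·)).card := by
  have hU : (insert (π.idx i) (openedBefore π.idx i))ᶜ =
      Finset.univ.filter fun b => i < π.opener b := by
    ext b
    simp only [Finset.mem_compl, Finset.mem_insert, mem_openedBefore, Finset.mem_filter,
      Finset.mem_univ, true_and, not_or, not_lt]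
    constructor
    · refine fun h => lt_of_le_of_ne h.2 fun hi => h.1 ?_
      rw [hi, idx_opener]
    · refine fun h => ⟨?_, h.le⟩
      rintro rfl
      exact h.not_ge (π.opener_idx_le i)
  have hb : π.idx i ∉ (insert (π.idx i) (openedBefore π.idx i))ᶜ := by simp
  have hcard := Finset.card_compl (insert (π.idx i) (openedBefore π.idx i))
  rw [Fintype.card_fin] at hcard
  rw [← hcard, ← card_filter_lt_add_card_filter_gt hb, hU, lobAt, rcbAt, card_filter_openers,
    card_filter_closers, Finset.filter_filter, Finset.filter_filter, add_assoc]
  congr 1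
  · congr 1
    ext b
    simp [idx_opener]
  · rw [← Finset.card_union_of_disjoint]
    · congr 1
      ext b
      have h1 := π.opener_le_closer b
      simp only [idx_closer, Finset.mem_union, Finset.mem_filter, Finset.mem_univ, true_and,
        mem_activeBefore]
      constructor
      · rintro ⟨h2, h3⟩
        obtain h | h | h := lt_trichotomy (π.opener b) i
        · exact Or.inr ⟨⟨h, h2.le⟩, h3⟩
        · rw [← h, idx_opener] at h3
          exact absurd h3 (lt_irrefl _)
        · exact Or.inl ⟨h, h3⟩
      · rintro (⟨h2, h3⟩ | ⟨⟨h2, h3⟩, h4⟩)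
        · exact ⟨h2.trans_le h1, h3⟩
        · refine ⟨lt_of_le_of_ne h3 fun hi => h4.ne ?_, h4⟩
          rw [hi, idx_closer]
    · refine Finset.disjoint_left.mpr fun b hb hb' => ?_
      simp only [Finset.mem_filter, mem_activeBefore] at hb hb'
      exact hb.2.1.asymm hb'.1.1

/-- The contribution of position `i` to `bInv`. -/
def bInvAt (i : Fin n) : ℕ :=
  if π.idx i ∈ openedBefore π.idx i then 0 else ((π.closedBefore i).filter (π.idx i < ·)).card

/-- The contribution of position `i` to `cbInv + C(k,2)`. -/
def cbInvAt (i : Fin n) : ℕ :=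
  if π.idx i ∈ openedBefore π.idx i then 0
  else (activeBefore π.idx ∅ i).card + (openedBefore π.idx i).card +
    ((π.closedBefore i).filter (· < π.idx i)).card

/-- The letters whose block is not yet opened are exactly the openers. -/
theorem sum_ite_mem_openedBefore (g : Fin n → ℕ) :
    ∑ i, (if π.idx i ∈ openedBefore π.idx i then 0 else g i) = ∑ b, g (π.opener b) := by
  rw [← Finset.sum_image (s := Finset.univ) (g := π.opener) (f := g)
    fun x _ y _ h => π.opener_injective h]
  simp only [← ite_not (p := _ ∈ _)]
  rw [← Finset.sum_filter]
  refine Finset.sum_congr ?_ fun _ _ => rfl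
  ext i
  simp only [Finset.mem_filter, Finset.mem_univ, true_and, mem_openedBefore, not_lt,
    Finset.mem_image]
  constructor
  · exact fun h => ⟨_, (π.opener_idx_le i).antisymm h⟩
  · rintro ⟨b, rfl⟩
    rw [idx_opener]

/-- A block inversion is charged to the opener of its left block, before which the right block is
already closed. -/
theorem sum_bInvAt : ∑ i, π.bInvAt i = π.bInv := by
  simp only [bInvAt]
  rw [sum_ite_mem_openedBefore, bInv, Finset.card_filter, Fintype.sum_prod_type]
  refine Finset.sum_congr rfl fun b _ => ?_
  rw [← Finset.card_filter]
  congr 1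
  ext c
  simp [idx_opener, mem_closedBefore, and_comm]

/-- The m-th opener is preceded by m - 1 opened blocks. -/
theorem sum_card_openedBefore_opener :
    ∑ b, (openedBefore π.idx (π.opener b)).card = k.choose 2 := by
  have h := sum_card_filter_lt π.openers
  rw [openers, Finset.card_image_of_injective _ π.opener_injective, Finset.card_univ,
    Fintype.card_fin, Finset.sum_image fun x _ y _ h => π.opener_injective h] at h
  rw [← h]
  refine Finset.sum_congr rfl fun b _ => ?_
  refine Eq.trans ?_ (π.card_filter_openers (· < π.opener b)).symm
  congr 1
  ext c
  simp [mem_openedBefore]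

theorem sum_cbInvAt : ∑ i, π.cbInvAt i = π.cbInv + k.choose 2 := by
  -- At an opener the closed blocks on either side and the active ones together make up |O|, so both
  -- contributions add to 2|O|.
  have h : ∑ i, π.cbInvAt i + ∑ i, π.bInvAt i = 2 * k.choose 2 := by
    simp only [cbInvAt, bInvAt]
    rw [sum_ite_mem_openedBefore, sum_ite_mem_openedBefore, ← Finset.sum_add_distrib,
      ← sum_card_openedBefore_opener π, Finset.mul_sum]
    refine Finset.sum_congr rfl fun b _ => ?_
    have h1 := card_filter_lt_add_card_filter_gt (π.idx_notMem_closedBefore (π.opener b))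
    have h2 := π.card_closedBefore_add_card_activeBefore (π.opener b)
    omega
  rw [sum_bInvAt] at h
  have := π.bInv_le_choose
  rw [cbInv]
  omega

variable {R : Type*} [CommSemiring R] (p q : R)

/-- At an opener, `bInvAt` and `cbInvAt` supply the closed blocks on each side, completing the rank
in A to the rank in O. -/
theorem letterWeight_mak (i : Fin n) :
    letterWeight p q (fun c a => p ^ c * q ^ a) (fun c _ => p ^ c) (openedBefore π.idx i)
      (activeBefore π.idx ∅ i) (π.idx i) =
      p ^ (π.rosAt i + π.lcsAt i + π.bInvAt i) * q ^ (π.lsbAt i + π.cbInvAt i) := by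
  rw [letterWeight, rosAt_add_lcsAt, lsbAt_eq, bInvAt, cbInvAt, ← closedBefore]
  split_ifs with h
  · simp only [pow_add, pow_zero]
    ring
  · simp only [card_filter_openedBefore, pow_add]
    ring

theorem letterWeight_mak' (i : Fin n) :
    letterWeight p q (fun c a => p ^ (k - (c + a + 1)) * q ^ a) (fun c a => p ^ (k - (c + a)))
      (openedBefore π.idx i) (activeBefore π.idx ∅ i) (π.idx i) =
      p ^ (π.lobAt i + π.rcbAt i + π.bInvAt i) * q ^ (π.lsbAt i + π.cbInvAt i) := by
  rw [letterWeight, lobAt_add_rcbAt, lsbAt_eq, bInvAt, cbInvAt, ← closedBefore,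
    card_closedBefore_add_card_activeBefore]
  split_ifs with h
  · simp only [Finset.insert_eq_of_mem h, pow_add, pow_zero]
    ring
  · simp only [Finset.card_insert_of_notMem h, card_filter_openedBefore, pow_add]
    ring

theorem wordWeight_mak :
    wordWeight p q (fun c a => p ^ c * q ^ a) (fun c _ => p ^ c) π.idx ∅ =
      p ^ (π.mak + π.bInv) * q ^ π.cinvLSB := by
  simp only [wordWeight, letterWeight_mak]
  rw [Finset.prod_mul_distrib, Finset.prod_pow_eq_pow_sum, Finset.prod_pow_eq_pow_sum,
    Finset.sum_add_distrib, Finset.sum_add_distrib, Finset.sum_add_distrib, sum_bInvAt,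
    sum_cbInvAt, mak, ros, lcs, cinvLSB, lsb, add_assoc (∑ i, π.lsbAt i)]

theorem wordWeight_mak' :
    wordWeight p q (fun c a => p ^ (k - (c + a + 1)) * q ^ a) (fun c a => p ^ (k - (c + a)))
      π.idx ∅ = p ^ (π.mak' + π.bInv) * q ^ π.cinvLSB := by
  simp only [wordWeight, letterWeight_mak']
  rw [Finset.prod_mul_distrib, Finset.prod_pow_eq_pow_sum, Finset.prod_pow_eq_pow_sum,
    Finset.sum_add_distrib, Finset.sum_add_distrib, Finset.sum_add_distrib, sum_bInvAt,
    sum_cbInvAt, mak', lob, rcb, cinvLSB, lsb, add_assoc (∑ i, π.lsbAt i)]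

/-! ### Ordered partitions as surjective words, and the generating functions. -/

/-- The ordered partition whose blocks are the fibres of a surjective word. -/
def ofWord (w : Fin n → Fin k) (hw : Finset.univ.image w = Finset.univ) :
    OrderedSetPartition n k :=
  ⟨fun b => Finset.univ.filter fun i => w i = b, fun b => by
      obtain ⟨i, -, hi⟩ := Finset.mem_image.mp (hw ▸ Finset.mem_univ b)
      exact ⟨i, by simp [hi]⟩,
    fun b c hbc => Finset.disjoint_left.mpr fun i hi hi' => hbc (by simp_all),
    fun i => ⟨w i, by simp⟩⟩

theorem idx_ofWord (w : Fin n → Fin k) (hw : Finset.univ.image w = Finset.univ) :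
    (ofWord w hw).idx = w := by
  funext i
  rw [idx_eq_iff]
  simp [ofWord, block]

theorem ofWord_idx : ofWord π.idx π.image_idx = π := by
  refine Subtype.ext (funext fun b => ?_)
  ext i
  simp [ofWord, idx_eq_iff, block]

theorem sum_idx (g : (Fin n → Fin k) → R) :
    ∑ π : OrderedSetPartition n k, g π.idx =
      ∑ w : Fin n → Fin k with Finset.univ.image w = Finset.univ, g w := by
  refine Finset.sum_bij' (fun π _ => π.idx) (fun w hw => ofWord w (Finset.mem_filter.mp hw).2)
    (fun π _ => ?_) (fun _ _ => Finset.mem_univ _) (fun π _ => π.ofWord_idx)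
    (fun w _ => idx_ofWord w _) (fun _ _ => rfl)
  simp [image_idx]

theorem sum_mak (n k : ℕ) :
    ∑ π : OrderedSetPartition n k, p ^ (π.mak + π.bInv) * q ^ π.cinvLSB =
      q ^ k.choose 2 * pqFactorial p q k * pqStirling p q n k := by
  simp only [← wordWeight_mak]
  rw [sum_idx fun w => wordWeight p q _ _ w ∅, sum_wordWeight, Fintype.card_fin, pathSum_mak]

theorem sum_mak' (n k : ℕ) :
    ∑ π : OrderedSetPartition n k, p ^ (π.mak' + π.bInv) * q ^ π.cinvLSB =
      q ^ k.choose 2 * pqFactorial p q k * pqStirling p q n k := by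
  simp only [← wordWeight_mak']
  rw [sum_idx fun w => wordWeight p q _ _ w ∅, sum_wordWeight, Fintype.card_fin, pathSum_mak']

end OrderedSetPartition

theorem theorem3p2 (n k : ℕ) (hk : 1 ≤ k) (hkn : k ≤ n) :
    (∀ (R : Type*) [CommSemiring R] (p q : R),
      (∑ π : OrderedSetPartition n k, p ^ (π.mak + π.bInv) * q ^ π.cinvLSB =
        q ^ k.choose 2 * pqFactorial p q k * pqStirling p q n k) ∧
      (∑ π : OrderedSetPartition n k, p ^ (π.mak' + π.bInv) * q ^ π.cinvLSB =
        q ^ k.choose 2 * pqFactorial p q k * pqStirling p q n k)) ∧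
    IsEulerMahonian (fun π : OrderedSetPartition n k => π.mak + π.bInv) ∧
    IsEulerMahonian (fun π : OrderedSetPartition n k => π.mak' + π.bInv) ∧
    IsEulerMahonian (fun π : OrderedSetPartition n k => π.cinvLSB) := by
  refine ⟨fun R _ p q => ⟨OrderedSetPartition.sum_mak p q n k,
    OrderedSetPartition.sum_mak' p q n k⟩, ?_, ?_, ?_⟩
  · have h := OrderedSetPartition.sum_mak (Polynomial.X : Polynomial ℕ) 1 n k
    simpa [IsEulerMahonian, qStirling, pqFactorial_one_right] using h
  · have h := OrderedSetPartition.sum_mak' (Polynomial.X : Polynomial ℕ) 1 n k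
    simpa [IsEulerMahonian, qStirling, pqFactorial_one_right] using h
  -- At p = 1 the prefactor q^C(k,2) is exactly what turns S_{1,q} into S_{q,1}.
  · have h := OrderedSetPartition.sum_mak 1 (Polynomial.X : Polynomial ℕ) n k
    rw [pqFactorial_one_left, mul_right_comm, pow_mul_pqStirling_one_left, mul_comm] at h
    simpa [IsEulerMahonian] using h
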